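/- Let $d\ge 2$ be an integer. Let $\mathcal{B}_d$ be the set of all closed, bounded, convex sets $B\subseteq\mathbb{R}^d$ with $B=-B$ and $\mathbf 0$ in the interior of $B$ (equivalently, the set of unit balls $\{\mathbf x : \|\mathbf x\|\le 1\}$ of norms $\|\cdot\|$ on $\mathbb{R}^d$), endowed with the Hausdorff metric induced by the Euclidean distance. Then there is a meagre set $\mathcal{M}\subseteq\mathcal{B}_d$ (that is, a countable union of nowhere dense subsets of $\mathcal{B}_d$) such that every norm $\|\cdot\|$ on $\mathbb{R}^d$ whose unit ball does not belong to $\mathcal{M}$ has the following property: for every integer $n\ge 1$ and every set $P\subseteq\mathbb{R}^d$ of $n$ points, the number of unordered pairs $\{\mathbf x,\mathbf y\}\subseteq P$ with $\|\mathbf x-\mathbf y\|=1$ is at most $\frac d2\, n\log_2 n$. -/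

import Mathlib

/-- A norm on `ℝ^d`: a seminorm that vanishes only at `0`. It is unrelated to the Euclidean norm
that `EuclideanSpace ℝ (Fin d)` carries. -/
structure DNorm (d : ℕ) extends Seminorm ℝ (EuclideanSpace ℝ (Fin d)) where
  eq_zero_of_map_eq_zero : ∀ x, toFun x = 0 → x = 0

/-- The closed, bounded, `0`-symmetric convex bodies in `ℝ^d` with `0` in the interior. As a subtype
of Mathlib's `ConvexBody` it carries the Hausdorff metric of the Euclidean distance. -/
abbrev SymmetricBody (d : ℕ) : Type :=
  {K : ConvexBody (EuclideanSpace ℝ (Fin d)) //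
    (∀ x ∈ K, -x ∈ K) ∧ (0 : EuclideanSpace ℝ (Fin d)) ∈ interior (K : Set (EuclideanSpace ℝ (Fin d)))}

namespace DNorm

variable {d : ℕ}

theorem continuous (N : DNorm d) : Continuous N.toSeminorm := by
  have h : ConvexOn ℝ Set.univ (N.toSeminorm : EuclideanSpace ℝ (Fin d) → ℝ) :=
    N.toSeminorm.convexOn
  exact continuousOn_univ.1 (h.continuousOn isOpen_univ)

theorem exists_pos_mul_norm_le (N : DNorm d) :
    ∃ c : ℝ, 0 < c ∧ ∀ x, c * ‖x‖ ≤ N.toSeminorm x := by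
  rcases (Metric.sphere (0 : EuclideanSpace ℝ (Fin d)) 1).eq_empty_or_nonempty with h | h
  · refine ⟨1, one_pos, fun x => ?_⟩
    by_cases hx : x = 0
    · simp [hx]
    · have : ‖x‖⁻¹ • x ∈ Metric.sphere (0 : EuclideanSpace ℝ (Fin d)) 1 := by
        simp [norm_smul, hx]
      simp [h] at this
  · obtain ⟨y, hy, hmin⟩ := (isCompact_sphere _ _).exists_isMinOn h N.continuous.continuousOn
    have hy0 : y ≠ 0 := by
      rintro rfl
      simp at hy
    refine ⟨N.toSeminorm y, ?_, fun x => ?_⟩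
    · exact lt_of_le_of_ne (apply_nonneg _ _) fun h0 => hy0 (N.eq_zero_of_map_eq_zero y h0.symm)
    · by_cases hx : x = 0
      · simp [hx]
      · have hs : ‖x‖⁻¹ • x ∈ Metric.sphere (0 : EuclideanSpace ℝ (Fin d)) 1 := by
          simp [norm_smul, hx]
        have h1 : N.toSeminorm y ≤ N.toSeminorm (‖x‖⁻¹ • x) := hmin hs
        rw [map_smul_eq_mul, norm_inv, norm_norm, inv_mul_eq_div,
          le_div_iff₀ (norm_pos_iff.2 hx)] at h1
        exact h1

/-- The unit ball `{x | N x ≤ 1}` of a norm `N` on `ℝ^d`, as a symmetric convex body. -/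
def unitBall (N : DNorm d) : SymmetricBody d :=
  ⟨{ carrier := {x | N.toSeminorm x ≤ 1}
     convex' := by simpa [Seminorm.closedBall_zero_eq] using N.toSeminorm.convex_closedBall 0 1
     isCompact' := by
       obtain ⟨c, hc, h⟩ := N.exists_pos_mul_norm_le
       refine (isCompact_closedBall (0 : EuclideanSpace ℝ (Fin d)) c⁻¹).of_isClosed_subset
         (isClosed_le N.continuous continuous_const) fun x hx => ?_
       rw [mem_closedBall_zero_iff, ← one_div, le_div_iff₀ hc, mul_comm]
       exact (h x).trans hx
     nonempty' := ⟨0, by simp⟩ },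
    fun x (hx : N.toSeminorm x ≤ 1) => show N.toSeminorm (-x) ≤ 1 by rwa [map_neg_eq_map],
    mem_interior.2 ⟨{x | N.toSeminorm x < 1}, fun x (hx : N.toSeminorm x < 1) => show N.toSeminorm x ≤ 1 from hx.le,
      isOpen_lt N.continuous continuous_const, by simp⟩⟩

/-- The unit distance graph of a norm `N` on `ℝ^d`: two points are adjacent iff their distance
according to `N` is one. -/
def unitDistanceGraph (N : DNorm d) : SimpleGraph (EuclideanSpace ℝ (Fin d)) where
  Adj x y := N.toSeminorm (x - y) = 1
  symm := ⟨fun x y h => by rw [← h, map_sub_rev]⟩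
  loopless := ⟨fun x h => by simp at h⟩

/-- The number of unit distances according to `N` among the points of the finite set `P`, that is,
the number of unordered pairs of points of `P` at distance one. -/
noncomputable def numUnitDistances (N : DNorm d) (P : Finset (EuclideanSpace ℝ (Fin d))) : ℕ :=
  (N.unitDistanceGraph.induce (P : Set (EuclideanSpace ℝ (Fin d)))).edgeSet.ncard

end DNorm

/-!
If finitely many boundary points of a body, no two of them opposite, number more than `d` times
their rational rank, then they are `k` rational combinations of `l` vectors with `d * l < k`. For
fixed coefficients, such `k`-tuples form a subspace of dimension at most `d * l`, and the bodies
whose boundary contains one of them with all points at mutual distance at least `η`, even up to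
sign, form a closed set. Its interior is empty: every norm is close to a uniformly convex one, whose
ball is close to a polytope with facets too small to contain two of the points up to sign. The tuple
then satisfies `k` linear equations, given by `k` different facets, and these have no solution in
the subspace once the constants of the facets are generic. So the bodies with such boundary points
form a meagre set.

For all other norms every set of unit differences, taken up to sign, has size at most `d` times its
rational rank, and a greedy (matroid) argument finds rationally independent unit differences
carrying at least the `d`-th part of all unit distances. Independent differences occur at most
`(n / 2) * log₂ n` times among `n` points: some linear functional changes only along one of them, so
cutting the set by its values separates the set along a single difference, and induction applies.
-/

section Logarithm

open Real

theorem le_logb_two_one_add {t : ℝ} (h0 : 0 ≤ t) (h1 : t ≤ 1) : t ≤ logb 2 (1 + t) := by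
  rw [le_logb_iff_rpow_le one_lt_two (by positivity)]
  simpa [one_add_one_eq_two] using rpow_one_add_le_one_add_mul_self (s := 1) (by norm_num) h0 h1

theorem mul_logb_add_mul_logb_add_two_mul_min_le {a b : ℝ} (ha : 0 < a) (hb : 0 < b) :
    a * logb 2 a + b * logb 2 b + 2 * min a b ≤ (a + b) * logb 2 (a + b) := by
  wlog hab : a ≤ b generalizing a b
  · have := this hb ha (le_of_not_ge hab)
    rwa [add_comm b a, min_comm b a, add_comm (b * _)] at this
  have h_small : 1 ≤ logb 2 (a + b) - logb 2 a := by
    rw [← logb_div (by positivity) ha.ne', le_logb_iff_rpow_le one_lt_two (by positivity), rpow_one,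
      le_div_iff₀ ha]
    linarith
  have h_large : a / b ≤ logb 2 (a + b) - logb 2 b := by
    rw [← logb_div (by positivity) hb.ne', add_div, div_self hb.ne', add_comm]
    exact le_logb_two_one_add (by positivity) ((div_le_one hb).2 hab)
  rw [div_le_iff₀ hb] at h_large
  rw [min_eq_left hab]
  linarith [mul_le_mul_of_nonneg_left h_small ha.le]

end Logarithm

section Translates

variable {V : Type*} [AddCommGroup V] [DecidableEq V]

/-- The number of ordered pairs of points of `P` with difference `u`, each counted by its first
point. -/
def translateCount (P : Finset V) (u : V) : ℕ := {x ∈ P | x + u ∈ P}.card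

theorem translateCount_eq_filter_add (P : Finset V) (u : V) (p : V → Prop) [DecidablePred p]
    (hp : ∀ x, p (x + u) → p x) :
    translateCount P u = translateCount {x ∈ P | p x} u + translateCount {x ∈ P | ¬p x} u +
      {x ∈ P | x + u ∈ P ∧ p x ∧ ¬p (x + u)}.card := by
  unfold translateCount
  rw [← Finset.card_union_of_disjoint, ← Finset.card_union_of_disjoint]
  · congr 1
    grind
  all_goals
    rw [Finset.disjoint_left]
    grind

theorem translateCount_le_filter_add_min (P : Finset V) (u : V) (p : V → Prop) [DecidablePred p]
    (hp : ∀ x, p (x + u) → p x) :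
    translateCount P u ≤ translateCount {x ∈ P | p x} u + translateCount {x ∈ P | ¬p x} u +
      min {x ∈ P | p x}.card {x ∈ P | ¬p x}.card := by
  rw [translateCount_eq_filter_add P u p hp]
  gcongr
  refine le_min (Finset.card_le_card (by grind)) ?_
  refine Finset.card_le_card_of_injOn (· + u) (fun x hx => ?_) (add_left_injective u).injOn
  simp only [Finset.mem_coe, Finset.mem_filter] at hx ⊢
  exact ⟨hx.2.1, hx.2.2.2⟩

theorem translateCount_eq_filter_add_of_iff (P : Finset V) (u : V) (p : V → Prop)
    [DecidablePred p] (hp : ∀ x, p (x + u) ↔ p x) :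
    translateCount P u = translateCount {x ∈ P | p x} u + translateCount {x ∈ P | ¬p x} u := by
  rw [translateCount_eq_filter_add P u p fun x => (hp x).1, Nat.add_eq_left, Finset.card_eq_zero]
  grind

theorem exists_dual_eq_one_of_linearIndepOn {K V : Type*} [Field K] [AddCommGroup V] [Module K V]
    {s : Set V} (hs : LinearIndepOn K id s) {u : V} (hu : u ∈ s) :
    ∃ φ : Module.Dual K V, φ u = 1 ∧ ∀ w ∈ s, w ≠ u → φ w = 0 := by
  have hnot : u ∉ Submodule.span K (s \ {u}) := by simpa using hs.notMem_span hu
  obtain ⟨g, hgu, hg⟩ := Submodule.exists_le_ker_of_notMem hnot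
  refine ⟨(g u)⁻¹ • g, by simp [hgu], fun w hw hwu => ?_⟩
  have hgw : g w = 0 := hg (Submodule.subset_span ⟨hw, hwu⟩)
  simp [hgw]

section OrderedField

variable {𝕜 : Type*} [Field 𝕜] [LinearOrder 𝕜] [IsStrictOrderedRing 𝕜] [Module 𝕜 V]

theorem sum_translateCount_le_filter_add_min (P : Finset V) {I : Finset V} {u : V} (hu : u ∈ I)
    (φ : Module.Dual 𝕜 V) (hφu : 0 ≤ φ u) (hφ : ∀ w ∈ I, w ≠ u → φ w = 0) (c : 𝕜) :
    ∑ w ∈ I, translateCount P w ≤ ∑ w ∈ I, translateCount {x ∈ P | φ x ≤ c} w +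
      ∑ w ∈ I, translateCount {x ∈ P | ¬φ x ≤ c} w +
      min {x ∈ P | φ x ≤ c}.card {x ∈ P | ¬φ x ≤ c}.card := by
  have h_cross := translateCount_le_filter_add_min P u (φ · ≤ c) fun x hx =>
    (le_add_of_nonneg_right hφu).trans (by rwa [← map_add])
  have h_rest : ∑ w ∈ I.erase u, translateCount P w =
      ∑ w ∈ I.erase u, translateCount {x ∈ P | φ x ≤ c} w +
        ∑ w ∈ I.erase u, translateCount {x ∈ P | ¬φ x ≤ c} w := by
    rw [← Finset.sum_add_distrib]
    refine Finset.sum_congr rfl fun w hw => ?_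
    obtain ⟨hwu, hwI⟩ := Finset.mem_erase.1 hw
    exact translateCount_eq_filter_add_of_iff P w (φ · ≤ c) fun x => by
      rw [map_add, hφ w hwI hwu, add_zero]
  simp only [← Finset.add_sum_erase I _ hu]
  omega

theorem two_mul_sum_translateCount_le {I : Finset V} (hI : LinearIndepOn 𝕜 id (I : Set V))
    (P : Finset V) :
    2 * ∑ u ∈ I, (translateCount P u : ℝ) ≤ P.card * Real.logb 2 P.card := by
  induction P using Finset.strongInduction with
  | H P ih =>
  by_cases h0 : ∀ u ∈ I, translateCount P u = 0
  · rw [Finset.sum_eq_zero fun u hu => by rw [h0 u hu, Nat.cast_zero], mul_zero]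
    exact mul_nonneg (Nat.cast_nonneg _)
      (div_nonneg (Real.log_natCast_nonneg _) (Real.log_nonneg one_le_two))
  push Not at h0
  obtain ⟨u, hu, hne⟩ := h0
  obtain ⟨x, hx⟩ := Finset.card_ne_zero.1 hne
  obtain ⟨hxP, hxuP⟩ := Finset.mem_filter.1 hx
  obtain ⟨φ, hφu, hφ⟩ := exists_dual_eq_one_of_linearIndepOn hI (Finset.mem_coe.2 hu)
  set A := {y ∈ P | φ y ≤ φ x}
  set B := {y ∈ P | ¬φ y ≤ φ x}
  have hxA : x ∈ A := Finset.mem_filter.2 ⟨hxP, le_rfl⟩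
  have hxB : x + u ∈ B := Finset.mem_filter.2 ⟨hxuP, by simp [hφu]⟩
  have hA := ih A (Finset.filter_ssubset.2 ⟨x + u, hxuP, (Finset.mem_filter.1 hxB).2⟩)
  have hB := ih B (Finset.filter_ssubset.2 ⟨x, hxP, not_not.2 le_rfl⟩)
  have hcard : (A.card + B.card : ℝ) = P.card := mod_cast Finset.card_filter_add_card_filter_not _
  have hsum : ∑ w ∈ I, (translateCount P w : ℝ) ≤ ∑ w ∈ I, (translateCount A w : ℝ) +
      ∑ w ∈ I, (translateCount B w : ℝ) + min (A.card : ℝ) B.card :=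
    mod_cast sum_translateCount_le_filter_add_min P hu φ (hφu ▸ zero_le_one) hφ (φ x)
  have hlog := mul_logb_add_mul_logb_add_two_mul_min_le
    (Nat.cast_pos.2 (Finset.card_pos.2 ⟨x, hxA⟩)) (Nat.cast_pos.2 (Finset.card_pos.2 ⟨x + u, hxB⟩))
  rw [hcard] at hlog
  linarith

end OrderedField

end Translates

section Rado

theorem exists_linearIndepOn_id_insert_subset_span {K V : Type*} [DivisionRing K] [AddCommGroup V]
    [Module K V] [DecidableEq V] {S I : Finset V} (hI : LinearIndepOn K id (I : Set V))
    (hSI : (S : Set V) ⊆ Submodule.span K (I : Set V)) (a : V) :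
    ∃ J : Finset V, I ⊆ J ∧ J ⊆ insert a I ∧ LinearIndepOn K id (J : Set V) ∧
      ((insert a S : Finset V) : Set V) ⊆ Submodule.span K (J : Set V) := by
  obtain ⟨J, hJ_le, hIJ, hspanJ, hJ⟩ :=
    exists_linearIndepOn_id_extension hI (Set.subset_insert a (I : Set V))
  lift J to Finset V using (I.finite_toSet.insert a).subset hJ_le
  refine ⟨J, Finset.coe_subset.1 hIJ, by simpa [← Finset.coe_subset] using hJ_le, hJ, ?_⟩
  rw [Finset.coe_insert]
  exact Set.insert_subset (hspanJ (Set.mem_insert _ _))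
    (hSI.trans (Submodule.span_le.2 ((Set.subset_insert _ _).trans hspanJ)))

theorem exists_linearIndepOn_sum_le {K V R : Type*} [DivisionRing K] [AddCommGroup V] [Module K V]
    [CommRing R] [LinearOrder R] [IsStrictOrderedRing R] {d : ℕ} {S : Finset V}
    (hS : ∀ T ⊆ S, T.card ≤ d * Module.finrank K (Submodule.span K (T : Set V)))
    {e : V → R} (he : ∀ u ∈ S, 0 ≤ e u) :
    ∃ I ⊆ S, LinearIndepOn K id (I : Set V) ∧ ∑ u ∈ S, e u ≤ d * ∑ u ∈ I, e u := by
  classical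
  -- Adding an element of least weight `e a` changes no sum of the excesses `e u - e a`.
  suffices h : ∃ I ⊆ S, LinearIndepOn K id (I : Set V) ∧
      (S : Set V) ⊆ Submodule.span K (I : Set V) ∧
      ∀ m, (∀ u ∈ S, m ≤ e u) → ∑ u ∈ S, (e u - m) ≤ d * ∑ u ∈ I, (e u - m) by
    obtain ⟨I, hIS, hI, -, hsum⟩ := h
    exact ⟨I, hIS, hI, by simpa using hsum 0 he⟩
  clear he
  induction S using Finset.induction_on_min_value e with
  | empty => exact ⟨∅, by simp⟩
  | insert a S haS hmin ih =>
    obtain ⟨I, hIS, hI, hspan, hsum⟩ := ih fun T hT => hS T (hT.trans (Finset.subset_insert _ _))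
    obtain ⟨J, hIJ, hJ_le, hJ, hspanJ⟩ := exists_linearIndepOn_id_insert_subset_span hI hspan a
    have hcard : (insert a S).card ≤ d * J.card := by
      refine (hS _ subset_rfl).trans (Nat.mul_le_mul_left d ?_)
      exact (Submodule.finrank_mono (Submodule.span_le.2 hspanJ)).trans
        (finrank_span_finset_le_card J)
    have hexcess : ∑ u ∈ I, (e u - e a) = ∑ u ∈ J, (e u - e a) :=
      Finset.sum_subset hIJ fun u huJ huI => by
        rw [(Finset.mem_insert.1 (hJ_le huJ)).resolve_right huI, sub_self]
    have hshift (T : Finset V) (m : R) :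
        ∑ u ∈ T, (e u - m) = ∑ u ∈ T, (e u - e a) + T.card * (e a - m) := by
      rw [← nsmul_eq_mul, ← Finset.sum_const, ← Finset.sum_add_distrib]
      simp only [sub_add_sub_cancel]
    refine ⟨J, hJ_le.trans (Finset.insert_subset_insert a hIS), hJ, hspanJ, fun m hm => ?_⟩
    have hm0 : 0 ≤ e a - m := sub_nonneg.2 (hm a (Finset.mem_insert_self _ _))
    calc ∑ u ∈ insert a S, (e u - m)
        = ∑ u ∈ S, (e u - e a) + (insert a S).card * (e a - m) := by
          rw [hshift, Finset.sum_insert haS, sub_self, zero_add]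
      _ ≤ d * ∑ u ∈ J, (e u - e a) + (d * J.card : ℕ) * (e a - m) := by
          gcongr
          exact hexcess ▸ hsum (e a) hmin
      _ = d * ∑ u ∈ J, (e u - m) := by
          rw [hshift J m, Nat.cast_mul, mul_add, mul_assoc]

end Rado

theorem two_mul_sum_translateCount_le_mul_card {𝕜 V : Type*} [Field 𝕜] [LinearOrder 𝕜]
    [IsStrictOrderedRing 𝕜] [AddCommGroup V] [DecidableEq V] [Module 𝕜 V] {d : ℕ} {S : Finset V}
    (hS : ∀ T ⊆ S, T.card ≤ d * Module.finrank 𝕜 (Submodule.span 𝕜 (T : Set V)))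
    (P : Finset V) :
    2 * ∑ u ∈ S, (translateCount P u : ℝ) ≤ d * (P.card * Real.logb 2 P.card) := by
  obtain ⟨I, -, hI, hSI⟩ :=
    exists_linearIndepOn_sum_le (e := fun u => (translateCount P u : ℝ)) hS fun _ _ => by positivity
  calc 2 * ∑ u ∈ S, (translateCount P u : ℝ)
      ≤ d * (2 * ∑ u ∈ I, (translateCount P u : ℝ)) := by linarith
    _ ≤ d * (P.card * Real.logb 2 P.card) :=
        mul_le_mul_of_nonneg_left (two_mul_sum_translateCount_le hI P) (Nat.cast_nonneg d)

theorem exists_subset_neg_notMem_forall_mem_or_neg_mem {V : Type*} [AddCommGroup V]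
    {D : Finset V} (hD : ∀ u ∈ D, -u ≠ u) :
    ∃ S ⊆ D, (∀ u ∈ S, -u ∉ S) ∧ ∀ u ∈ D, u ∈ S ∨ -u ∈ S := by
  classical
  induction D using Finset.induction_on with
  | empty => exact ⟨∅, by simp⟩
  | insert a D _ ih =>
    obtain ⟨S, hSD, hneg, hcover⟩ := ih fun u hu => hD u (Finset.mem_insert_of_mem hu)
    by_cases haS : -a ∈ S
    · exact ⟨S, by grind, hneg, by grind⟩
    · exact ⟨insert a S, by grind, by grind [neg_neg], by grind⟩

theorem ncard_edgeSet_induce_le_sum_translateCount {V : Type*} [AddCommGroup V] [DecidableEq V]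
    (G : SimpleGraph V) {P S : Finset V}
    (hS : ∀ x ∈ P, ∀ y ∈ P, G.Adj x y → x - y ∈ S ∨ y - x ∈ S) :
    (G.induce (P : Set V)).edgeSet.ncard ≤ ∑ u ∈ S, translateCount P u := by
  let F := (S.sigma fun u => {x ∈ P | x + u ∈ P}).image fun p => s(p.2, p.2 + p.1)
  have hF : Sym2.map Subtype.val '' (G.induce (P : Set V)).edgeSet ⊆ (F : Set (Sym2 V)) := by
    rintro _ ⟨z, hz, rfl⟩
    induction z using Sym2.ind with
    | _ x y =>
    simp only [F, Sym2.map_mk, Finset.coe_image, Set.mem_image, Finset.mem_coe, Finset.mem_sigma,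
      Finset.mem_filter]
    rcases hS x x.2 y y.2 hz with h | h
    · exact ⟨⟨x.1 - y.1, y.1⟩, ⟨h, y.2, by simp⟩, by simp [Sym2.eq_swap]⟩
    · exact ⟨⟨y.1 - x.1, x.1⟩, ⟨h, x.2, by simp⟩, by simp⟩
  calc (G.induce (P : Set V)).edgeSet.ncard
      = (Sym2.map Subtype.val '' (G.induce (P : Set V)).edgeSet).ncard :=
        (Set.ncard_image_of_injective _ (Sym2.map.injective Subtype.val_injective)).symm
    _ ≤ F.card := by
        rw [← Set.ncard_coe_finset]
        exact Set.ncard_le_ncard hF F.finite_toSet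
    _ ≤ (S.sigma fun u => {x ∈ P | x + u ∈ P}).card := Finset.card_image_le
    _ = ∑ u ∈ S, translateCount P u := Finset.card_sigma _ _

section Generic

theorem dense_setOf_forall_notMem_of_isClosed_of_ne_top {𝕜 E α : Type*}
    [NontriviallyNormedField 𝕜] [NormedAddCommGroup E] [NormedSpace 𝕜 E] [CompleteSpace E]
    [Countable α] {p : α → Submodule 𝕜 E} (hclosed : ∀ a, IsClosed (p a : Set E))
    (hp : ∀ a, p a ≠ ⊤) : Dense {x | ∀ a, x ∉ p a} := by
  have h := dense_iInter_of_isOpen (fun a => (hclosed a).isOpen_compl) fun a =>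
    interior_eq_empty_iff_dense_compl.1 <| Set.not_nonempty_iff_eq_empty.1 fun hne =>
      hp a ((p a).eq_top_of_nonempty_interior' hne)
  convert h using 1
  ext x
  simp

theorem comap_map_ne_top_of_finrank_lt {K E F G : Type*} [DivisionRing K] [AddCommGroup E]
    [Module K E] [AddCommGroup F] [Module K F] [AddCommGroup G] [Module K G] {W : Submodule K E}
    [Module.Finite K W] (hW : Module.finrank K W < Module.finrank K F) (L : E →ₗ[K] F)
    {D : G →ₗ[K] F} (hD : Function.Surjective D) : (W.map L).comap D ≠ ⊤ := fun htop => by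
  have hmap : W.map L = ⊤ := by
    rw [← Submodule.map_comap_eq_of_surjective hD (W.map L), htop, Submodule.map_top,
      LinearMap.range_eq_top.2 hD]
  have hle := Submodule.finrank_map_le L W
  rw [hmap, finrank_top] at hle
  exact hW.not_ge hle

theorem exists_Ioo_forall_exists_abs_apply_ne {κ ι E : Type*} [Fintype κ] [Finite ι]
    [AddCommGroup E] [Module ℝ E] [FiniteDimensional ℝ E] {W : Submodule ℝ (κ → E)}
    (hW : Module.finrank ℝ W < Fintype.card κ) (f : ι → Module.Dual ℝ E) {a b : ℝ} (hab : a < b) :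
    ∃ β : ι → ℝ, (∀ i, β i ∈ Set.Ioo a b) ∧
      ∀ i : κ → ι, Function.Injective i → ∀ u ∈ W, ∃ r, |f (i r) (u r)| ≠ β (i r) := by
  have := Fintype.ofFinite ι
  -- The constants `β` to avoid are those with `D i σ β ∈ W.map (L i)` for some signs `σ`.
  let L (i : κ → ι) : (κ → E) →ₗ[ℝ] κ → ℝ := LinearMap.pi fun r => f (i r) ∘ₗ LinearMap.proj r
  let D (i : κ → ι) (σ : κ → ℤˣ) : (ι → ℝ) →ₗ[ℝ] κ → ℝ :=
    LinearMap.pi fun r => (σ r : ℤ) • LinearMap.proj (i r)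
  have hD {i : κ → ι} (hi : Function.Injective i) (σ) : Function.Surjective (D i σ) := fun z =>
    ⟨Function.extend i (fun r => (σ r : ℤ) • z r) 0, funext fun r => by
      simp [D, hi.extend_apply, ← mul_assoc, ← Int.cast_mul, ← Units.val_mul]⟩
  have hproper (q : {i : κ → ι // Function.Injective i} × (κ → ℤˣ)) :
      (W.map (L q.1)).comap (D q.1 q.2) ≠ ⊤ :=
    comap_map_ne_top_of_finrank_lt (hW.trans_eq (Module.finrank_fintype_fun_eq_card ℝ).symm) _
      (hD q.1.2 q.2)
  obtain ⟨β, hβ, hβab⟩ := (dense_setOf_forall_notMem_of_isClosed_of_ne_top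
    (fun q => Submodule.closed_of_finiteDimensional _) hproper).exists_mem_open
    (isOpen_set_pi Set.finite_univ fun _ _ => isOpen_Ioo)
    (Set.univ_pi_nonempty_iff.2 fun _ : ι => Set.nonempty_Ioo.2 hab)
  refine ⟨β, fun i => hβab i trivial, fun i hi u hu => ?_⟩
  by_contra! h
  have hσ (r) : ∃ σ : ℤˣ, f (i r) (u r) = (σ : ℤ) • β (i r) := by
    rw [← h r]
    rcases abs_choice (f (i r) (u r)) with h' | h'
    · exact ⟨1, by simp [h']⟩
    · exact ⟨-1, by simp [h']⟩
  choose σ hσ using hσ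
  exact hβ ⟨⟨i, hi⟩, σ⟩ ⟨u, hu, funext hσ⟩

end Generic

section Rounding

variable {E : Type*} [NormedAddCommGroup E]

section NormedSpace

variable [NormedSpace ℝ E]

/-- The seminorm `√(N² + s²‖·‖²)`. In an inner product space it is uniformly convex for `s ≠ 0`,
whatever `N` is, which makes it a strictly convex perturbation of `N`. -/
noncomputable def roundedSeminorm (N : Seminorm ℝ E) (s : ℝ) : Seminorm ℝ E :=
  Seminorm.of (fun x => √(N x ^ 2 + (s * ‖x‖) ^ 2))
    (fun x y => by
      have h1 := pow_le_pow_left₀ (apply_nonneg N _) (map_add_le_add N x y) 2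
      have h2 : (s * ‖x + y‖) ^ 2 ≤ (s * ‖x‖ + s * ‖y‖) ^ 2 := by
        rw [← mul_add, mul_pow, mul_pow]
        gcongr
        exact norm_add_le x y
      rw [Real.sqrt_le_left (by positivity), add_sq,
        Real.sq_sqrt (by positivity), Real.sq_sqrt (by positivity), mul_assoc,
        ← Real.sqrt_mul (by positivity)]
      have h3 : N x * N y + s * ‖x‖ * (s * ‖y‖) ≤
          √((N x ^ 2 + (s * ‖x‖) ^ 2) * (N y ^ 2 + (s * ‖y‖) ^ 2)) :=
        Real.le_sqrt_of_sq_le (by linarith [sq_nonneg (N x * (s * ‖y‖) - N y * (s * ‖x‖))])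
      linarith)
    fun c x => by
      rw [map_smul_eq_mul, norm_smul, mul_left_comm, mul_pow, mul_pow _ (s * ‖x‖), ← mul_add,
        Real.sqrt_mul (sq_nonneg _), Real.sqrt_sq (norm_nonneg c)]

variable (N : Seminorm ℝ E) (s : ℝ)

theorem roundedSeminorm_sq (x : E) : roundedSeminorm N s x ^ 2 = N x ^ 2 + (s * ‖x‖) ^ 2 :=
  Real.sq_sqrt (by positivity)

theorem le_roundedSeminorm (x : E) : N x ≤ roundedSeminorm N s x :=
  Real.le_sqrt_of_sq_le (le_add_of_nonneg_right (sq_nonneg _))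

theorem roundedSeminorm_pos {s : ℝ} (hs : s ≠ 0) {x : E} (hx : x ≠ 0) :
    0 < roundedSeminorm N s x :=
  Real.sqrt_pos.2 (by positivity)

theorem roundedSeminorm_le_of_le_one {x : E} (hx : N x ≤ 1) {t : ℝ} (ht : 0 ≤ t)
    (hst : |s * ‖x‖| ≤ t) : roundedSeminorm N s x ≤ 1 + t := by
  refine Real.sqrt_le_iff.2 ⟨by positivity, ?_⟩
  have h1 := pow_le_one₀ (n := 2) (apply_nonneg N x) hx
  have h2 := sq_le_sq' (abs_le.1 hst).1 (abs_le.1 hst).2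
  linarith [add_sq 1 t]

theorem continuous_roundedSeminorm {N : Seminorm ℝ E} (hN : Continuous N) (s : ℝ) :
    Continuous (roundedSeminorm N s) :=
  ((hN.pow 2).add ((continuous_const.mul continuous_norm).pow 2)).sqrt

end NormedSpace

variable [InnerProductSpace ℝ E] (N : Seminorm ℝ E) (s : ℝ)

theorem roundedSeminorm_add_sq_add_sq_le (u v : E) :
    roundedSeminorm N s (u + v) ^ 2 + (s * ‖u - v‖) ^ 2 ≤
      2 * (roundedSeminorm N s u ^ 2 + roundedSeminorm N s v ^ 2) := by
  have h1 := pow_le_pow_left₀ (apply_nonneg N _) (map_add_le_add N u v) 2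
  have h2 := congrArg (s ^ 2 * ·) (parallelogram_law_with_norm ℝ u v)
  simp only [roundedSeminorm_sq]
  linarith [sq_nonneg (N u - N v)]

theorem sq_mul_norm_sub_le_of_apply_eq {f : Module.Dual ℝ E}
    (hf : ∀ x, |f x| ≤ roundedSeminorm N s x) {u v : E} (huv : f u = f v) (hfu : 1 ≤ |f u|) {m : ℝ}
    (hu : roundedSeminorm N s u ≤ m) (hv : roundedSeminorm N s v ≤ m) :
    (s * ‖u - v‖) ^ 2 ≤ 4 * (m ^ 2 - 1) := by
  have h_mid : 2 ≤ roundedSeminorm N s (u + v) := by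
    refine le_trans ?_ (hf (u + v))
    rw [map_add, ← huv, ← two_mul, abs_mul, abs_two]
    linarith
  have h1 := pow_le_pow_left₀ zero_le_two h_mid 2
  have h2 := pow_le_pow_left₀ (apply_nonneg _ _) hu 2
  have h3 := pow_le_pow_left₀ (apply_nonneg _ _) hv 2
  linarith [roundedSeminorm_add_sq_add_sq_le N s u v]

theorem sq_mul_norm_sub_le_or_sq_mul_norm_add_le {f : Module.Dual ℝ E}
    (hf : ∀ x, |f x| ≤ roundedSeminorm N s x) {u v : E} (huv : |f u| = |f v|) (hfu : 1 ≤ |f u|)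
    {m : ℝ} (hu : roundedSeminorm N s u ≤ m) (hv : roundedSeminorm N s v ≤ m) :
    (s * ‖u - v‖) ^ 2 ≤ 4 * (m ^ 2 - 1) ∨ (s * ‖u + v‖) ^ 2 ≤ 4 * (m ^ 2 - 1) := by
  rcases abs_eq_abs.1 huv with h | h
  · exact .inl (sq_mul_norm_sub_le_of_apply_eq N s hf h hfu hu hv)
  · rw [← map_neg] at h
    rw [← map_neg_eq_map] at hv
    exact .inr (by simpa using sq_mul_norm_sub_le_of_apply_eq N s hf h hfu hu hv)

end Rounding

section Supporting

theorem exists_dual_abs_le_seminorm_apply_eq {E : Type*} [AddCommGroup E] [Module ℝ E]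
    (p : Seminorm ℝ E) (x : E) :
    ∃ f : Module.Dual ℝ E, (∀ y, |f y| ≤ p y) ∧ f x = p x := by
  rcases eq_or_ne x 0 with rfl | hx
  · exact ⟨0, fun y => by simp, by simp⟩
  obtain ⟨f, hfx, hf⟩ := Module.Dual.exists_extension_of_le_seminorm_real (ℝ ∙ x)
    (p x • (LinearEquiv.coord ℝ E x hx : (ℝ ∙ x) →ₗ[ℝ] ℝ)) (p := p) fun y => by
      rw [← LinearEquiv.coord_apply_smul ℝ E x hx y, map_smul_eq_mul, mul_comm]
      exact mul_le_mul_of_nonneg_left (le_abs_self _) (apply_nonneg p x)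
  refine ⟨f, hf, (hfx ⟨x, Submodule.mem_span_singleton_self x⟩).trans ?_⟩
  simp [LinearEquiv.coord_self]

theorem exists_finset_dual_abs_le_seminorm_lt_mul {E : Type*} [NormedAddCommGroup E]
    [NormedSpace ℝ E] [FiniteDimensional ℝ E] {p : Seminorm ℝ E} (hp : Continuous p)
    (hpos : ∀ x ≠ 0, 0 < p x) {c : ℝ} (hc : 1 < c) :
    ∃ t : Finset (Module.Dual ℝ E), (∀ f ∈ t, ∀ x, |f x| ≤ p x) ∧
      ∀ x ≠ 0, ∃ f ∈ t, p x < c * f x := by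
  classical
  choose f hf hfx using exists_dual_abs_le_seminorm_apply_eq p
  obtain ⟨t, -, ht⟩ := (isCompact_sphere (0 : E) 1).elim_nhds_subcover
    (fun x => {y | p y < c * f x y}) fun x hx => by
      refine (isOpen_lt hp
        (continuous_const.mul (f x).continuous_of_finiteDimensional)).mem_nhds ?_
      have hx0 := hpos x (ne_zero_of_mem_unit_sphere ⟨x, hx⟩)
      simpa [hfx] using lt_mul_of_one_lt_left hx0 hc
  refine ⟨t.image f, by simpa using fun x _ => hf x, fun y hy => ?_⟩
  have hy0 : 0 < ‖y‖⁻¹ := inv_pos.2 (norm_pos_iff.2 hy)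
  obtain ⟨x, hx, hxy⟩ := Set.mem_iUnion₂.1 (ht (show ‖y‖⁻¹ • y ∈ Metric.sphere (0 : E) 1 by
    simp [norm_smul, hy]))
  refine ⟨f x, Finset.mem_image_of_mem f hx, lt_of_mul_lt_mul_left ?_ hy0.le⟩
  simpa [map_smul_eq_mul, mul_left_comm] using hxy

end Supporting

section SymmetricPolytope

section Module

variable {E ι : Type*} [AddCommGroup E] [Module ℝ E]

/-- The intersection of the symmetric slabs `|f i| ≤ β i`. It need not be bounded. -/
def symmetricPolytope (f : ι → Module.Dual ℝ E) (β : ι → ℝ) : Set E := {x | ∀ i, |f i x| ≤ β i}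

theorem convex_symmetricPolytope {f : ι → Module.Dual ℝ E} {β : ι → ℝ} :
    Convex ℝ (symmetricPolytope f β) := by
  have h : symmetricPolytope f β = ⋂ i, f i ⁻¹' Set.Icc (-β i) (β i) := by
    ext x
    simp [symmetricPolytope, abs_le]
  exact h ▸ convex_iInter fun i => (convex_Icc _ _).linear_preimage (f i)

end Module

variable {E ι : Type*} [NormedAddCommGroup E] [NormedSpace ℝ E] [FiniteDimensional ℝ E]
  {f : ι → Module.Dual ℝ E} {β : ι → ℝ}

theorem isClosed_symmetricPolytope : IsClosed (symmetricPolytope f β) := by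
  simp only [symmetricPolytope, Set.ofPred_forall]
  exact isClosed_iInter fun i =>
    isClosed_le (f i).continuous_of_finiteDimensional.abs continuous_const

theorem exists_abs_apply_eq_of_mem_frontier_symmetricPolytope [Finite ι] {x : E}
    (hx : x ∈ frontier (symmetricPolytope f β)) : ∃ i, |f i x| = β i := by
  by_contra! h
  have hopen : IsOpen {y | ∀ i, |f i y| < β i} := by
    simp only [Set.ofPred_forall]
    exact isOpen_iInter_of_finite fun i =>
      isOpen_lt (f i).continuous_of_finiteDimensional.abs continuous_const
  exact hx.2 <| interior_maximal (fun y hy i => (hy i).le) hopen fun i =>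
    (isClosed_symmetricPolytope.frontier_subset hx i).lt_of_ne (h i)

end SymmetricPolytope

section ConvexBodies

variable {E : Type*} [NormedAddCommGroup E] [NormedSpace ℝ E]

theorem exists_mem_dist_lt_of_dist_lt {K L : ConvexBody E} {x : E} (hx : x ∈ K) {δ : ℝ}
    (hKL : dist K L < δ) : ∃ y ∈ L, dist x y < δ :=
  Metric.exists_dist_lt_of_hausdorffDist_lt hx (by rwa [ConvexBody.hausdorffDist_coe])
    ConvexBody.hausdorffEDist_ne_top

theorem ball_sub_dist_subset_of_ball_subset {K L : ConvexBody E} {x : E} {r : ℝ}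
    (hx : Metric.ball x r ⊆ K) : Metric.ball x (r - dist K L) ⊆ L := by
  intro y hy
  by_contra hyL
  obtain ⟨f, c, hfL, hfy⟩ := geometric_hahn_banach_closed_point L.convex L.isClosed hyL
  obtain ⟨z₀, hz₀⟩ := L.nonempty
  have hf : 0 < ‖f‖ := norm_pos_iff.2 fun h => by simpa [h] using (hfL z₀ hz₀).trans hfy
  obtain ⟨δ, hKLδ, hδr⟩ := exists_between (lt_sub_comm.1 (Metric.mem_ball.1 hy))
  obtain ⟨ρ, hKLρ, hρδ⟩ := exists_between hKLδ
  have hρ : 0 < ρ := dist_nonneg.trans_lt hKLρ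
  have hδ : 0 < δ := hρ.trans hρδ
  obtain ⟨a, ha, hfa⟩ : ∃ a, ‖a‖ < 1 ∧ ‖f‖ * ρ / δ < f a := by
    obtain ⟨a, ha, hfa⟩ := f.exists_lt_apply_of_lt_opNorm (r := ‖f‖ * ρ / δ)
      ((div_lt_iff₀ hδ).2 (mul_lt_mul_of_pos_left hρδ hf))
    rcases lt_abs.1 hfa with h | h
    · exact ⟨a, ha, h⟩
    · exact ⟨-a, by rwa [norm_neg], by rwa [map_neg]⟩
  have hyK : y + δ • a ∈ K := hx <| by
    rw [Metric.mem_ball, dist_eq_norm, add_sub_right_comm]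
    refine (norm_add_le _ _).trans_lt ?_
    rw [← dist_eq_norm, norm_smul, Real.norm_of_nonneg hδ.le]
    linarith [mul_lt_of_lt_one_right hδ ha]
  obtain ⟨z, hz, hyz⟩ := exists_mem_dist_lt_of_dist_lt hyK hKLρ
  have hupper : f (y + δ • a) - f z ≤ ‖f‖ * ρ := by
    rw [← map_sub]
    refine (le_abs_self _).trans ((f.le_opNorm _).trans ?_)
    rw [← dist_eq_norm]
    exact mul_le_mul_of_nonneg_left hyz.le hf.le
  have hlower : ‖f‖ * ρ < δ * f a := by rwa [div_lt_iff₀' hδ] at hfa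
  rw [map_add, map_smul, smul_eq_mul] at hupper
  linarith [hfL z hz]

theorem isOpen_setOf_mem_interior_convexBody :
    IsOpen {p : ConvexBody E × E | p.2 ∈ interior (p.1 : Set E)} := by
  refine Metric.isOpen_iff.2 fun ⟨K, x⟩ hx => ?_
  obtain ⟨r, hr, hball⟩ := Metric.isOpen_iff.1 isOpen_interior x hx
  refine ⟨r / 2, half_pos hr, fun ⟨L, y⟩ hLy => ?_⟩
  obtain ⟨hL, hy⟩ := max_lt_iff.1 (Metric.mem_ball.1 hLy)
  refine mem_interior.2 ⟨Metric.ball x (r - dist K L),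
    ball_sub_dist_subset_of_ball_subset (hball.trans interior_subset), Metric.isOpen_ball, ?_⟩
  rw [dist_comm] at hL
  exact Metric.mem_ball.2 (by linarith)

theorem isClosed_setOf_mem_convexBody : IsClosed {p : ConvexBody E × E | p.2 ∈ p.1} := by
  refine isClosed_of_closure_subset fun ⟨K, x⟩ hx => ?_
  refine K.isClosed.closure_subset (Metric.mem_closure_iff.2 fun ε hε => ?_)
  obtain ⟨⟨L, y⟩, hyL, hLy⟩ := Metric.mem_closure_iff.1 hx (ε / 2) (half_pos hε)
  obtain ⟨hL, hy⟩ := max_lt_iff.1 hLy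
  rw [dist_comm] at hL
  obtain ⟨z, hz, hyz⟩ := exists_mem_dist_lt_of_dist_lt hyL hL
  exact ⟨z, hz, by linarith [dist_triangle x y z]⟩

theorem isClosed_setOf_mem_frontier_convexBody :
    IsClosed {p : ConvexBody E × E | p.2 ∈ frontier (p.1 : Set E)} := by
  have h : {p : ConvexBody E × E | p.2 ∈ frontier (p.1 : Set E)} =
      {p | p.2 ∈ p.1} ∩ {p | p.2 ∈ interior (p.1 : Set E)}ᶜ := by
    ext p
    simp [p.1.isClosed.frontier_eq]
  exact h ▸ isClosed_setOf_mem_convexBody.inter isOpen_setOf_mem_interior_convexBody.isClosed_compl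

theorem norm_le_add_of_dist_lt {K L : ConvexBody E} {R δ : ℝ} (hL : ∀ y ∈ L, ‖y‖ ≤ R)
    (hKL : dist K L < δ) {x : E} (hx : x ∈ K) : ‖x‖ ≤ R + δ := by
  obtain ⟨y, hy, hxy⟩ := exists_mem_dist_lt_of_dist_lt hx hKL
  rw [dist_eq_norm] at hxy
  linarith [norm_le_norm_add_norm_sub' x y, hL y hy]

theorem dist_le_mul_of_inv_smul_mem {K L : ConvexBody E} {τ R : ℝ} (hτ : 0 ≤ τ)
    (hKR : ∀ x ∈ K, ‖x‖ ≤ R) (hKL : ∀ x ∈ K, (1 + τ)⁻¹ • x ∈ L)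
    (hLK : ∀ x ∈ L, (1 + τ)⁻¹ • x ∈ K) : dist K L ≤ τ * R := by
  have hτ1 : 0 < 1 + τ := by linarith
  have hR : 0 ≤ R := K.nonempty.elim fun x hx => (norm_nonneg x).trans (hKR x hx)
  have hdist (x : E) : dist x ((1 + τ)⁻¹ • x) = τ * ‖(1 + τ)⁻¹ • x‖ := by
    obtain ⟨y, rfl⟩ : ∃ y, x = (1 + τ) • y := ⟨_, (smul_inv_smul₀ hτ1.ne' x).symm⟩
    rw [inv_smul_smul₀ hτ1.ne', dist_eq_norm, add_smul, one_smul, add_sub_cancel_left, norm_smul,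
      Real.norm_of_nonneg hτ]
  have hshrink (x : E) : ‖(1 + τ)⁻¹ • x‖ ≤ ‖x‖ := by
    rw [norm_smul, Real.norm_of_nonneg (inv_nonneg.2 hτ1.le)]
    exact mul_le_of_le_one_left (norm_nonneg x) (inv_le_one_of_one_le₀ (by linarith))
  rw [← ConvexBody.hausdorffDist_coe]
  refine Metric.hausdorffDist_le_of_mem_dist (by positivity) (fun x hx => ⟨_, hKL x hx, ?_⟩)
    fun x hx => ⟨_, hLK x hx, ?_⟩
  · exact hdist x ▸ mul_le_mul_of_nonneg_left ((hshrink x).trans (hKR x hx)) hτ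
  · exact hdist x ▸ mul_le_mul_of_nonneg_left (hKR _ (hLK x hx)) hτ

theorem exists_convexBody_coe_eq_dist_le [ProperSpace E] {K : ConvexBody E} {C : Set E}
    (hconv : Convex ℝ C) (hclosed : IsClosed C) {τ R : ℝ} (hτ : 0 ≤ τ) (hKR : ∀ x ∈ K, ‖x‖ ≤ R)
    (hKC : ∀ x ∈ K, (1 + τ)⁻¹ • x ∈ C) (hCK : ∀ x ∈ C, (1 + τ)⁻¹ • x ∈ K) :
    ∃ L : ConvexBody E, (L : Set E) = C ∧ dist K L ≤ τ * R := by
  have hτ1 : 0 < 1 + τ := by linarith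
  have hbounded : C ⊆ Metric.closedBall 0 ((1 + τ) * R) := fun x hx => by
    have hxR := hKR _ (hCK x hx)
    rwa [norm_smul, Real.norm_of_nonneg (inv_nonneg.2 hτ1.le), inv_mul_le_iff₀ hτ1,
      ← mem_closedBall_zero_iff] at hxR
  let L : ConvexBody E := ⟨C, hconv, (isCompact_closedBall _ _).of_isClosed_subset hclosed hbounded,
    K.nonempty.elim fun x hx => ⟨_, hKC x hx⟩⟩
  exact ⟨L, rfl, dist_le_mul_of_inv_smul_mem hτ hKR hKC hCK⟩

open Pointwise in
theorem zero_mem_interior_of_smul_mem {A B : Set E} {c : ℝ} (hc : c ≠ 0) (hA : 0 ∈ interior A)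
    (h : ∀ x ∈ A, c • x ∈ B) : 0 ∈ interior B := by
  refine interior_mono (Set.smul_set_subset_iff.2 h) ?_
  rw [interior_smul₀ hc, ← smul_zero c]
  exact Set.smul_mem_smul_set hA

theorem exists_continuous_seminorm_le_one_iff_mem {C : Set E} (hconv : Convex ℝ C)
    (hclosed : IsClosed C) (hneg : ∀ x ∈ C, -x ∈ C) (h0 : 0 ∈ interior C) :
    ∃ N : Seminorm ℝ E, Continuous N ∧ ∀ x, N x ≤ 1 ↔ x ∈ C := by
  have hnhds : C ∈ nhds (0 : E) := mem_interior_iff_mem_nhds.1 h0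
  refine ⟨gaugeSeminorm ((balanced_iff_neg_mem hconv).2 fun x hx => hneg x hx) hconv
    (absorbent_nhds_zero hnhds), continuous_gauge hconv hnhds, fun x => ?_⟩
  exact (gauge_le_one_iff_mem_closure hconv hnhds).trans (by rw [hclosed.closure_eq])

theorem mem_frontier_setOf_le_one {N : Seminorm ℝ E} {x : E} (hx : N x = 1) :
    x ∈ frontier {y | N y ≤ 1} := by
  refine ⟨subset_closure hx.le, fun hint => ?_⟩
  have hc : Filter.Tendsto (fun t : ℝ => t • x) (nhds 1) (nhds x) := by
    have : Continuous fun t : ℝ => t • x := by fun_prop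
    simpa using this.tendsto 1
  obtain ⟨t, ht, ht1⟩ := (((hc.mono_left nhdsWithin_le_nhds).eventually
    (mem_interior_iff_mem_nhds.1 hint)).and (self_mem_nhdsWithin (s := Set.Ioi 1))).exists
  rw [map_smul_eq_mul, hx, mul_one, Real.norm_eq_abs] at ht
  exact ((le_abs_self t).trans ht).not_gt ht1

end ConvexBodies

section BoundaryTuples

open Filter Topology

variable {E κ : Type*}

section NormedSpace

variable [NormedAddCommGroup E] [NormedSpace ℝ E]

/-- Some tuple in `W` consists of boundary points of `C` that are pairwise at distance at least `η`
even up to sign. The separation makes this a closed condition on convex bodies. -/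
def HasSeparatedBoundaryTuple (W : Submodule ℝ (κ → E)) (η : ℝ) (C : Set E) : Prop :=
  ∃ u ∈ W, (∀ r, u r ∈ frontier C) ∧ Pairwise fun r s => η ≤ ‖u r - u s‖ ∧ η ≤ ‖u r + u s‖

theorem isClosed_setOf_hasSeparatedBoundaryTuple [FiniteDimensional ℝ E] [Finite κ]
    (W : Submodule ℝ (κ → E)) (η : ℝ) :
    IsClosed {K : ConvexBody E | HasSeparatedBoundaryTuple W η K} := by
  refine IsSeqClosed.isClosed fun K L hK hKL => ?_
  choose u huW hu hsep using hK
  obtain ⟨R, hR, hLR⟩ := L.isBounded.exists_pos_norm_le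
  have := Fintype.ofFinite κ
  have hbounded : ∀ᶠ n in atTop, u n ∈ Metric.closedBall (0 : κ → E) (R + 1) := by
    filter_upwards [hKL.eventually (Metric.ball_mem_nhds L one_pos)] with n hn
    rw [mem_closedBall_zero_iff, pi_norm_le_iff_of_nonneg (by positivity)]
    exact fun r => norm_le_add_of_dist_lt hLR hn ((K n).isClosed.frontier_subset (hu n r))
  obtain ⟨v, -, φ, hφ, hv⟩ :=
    tendsto_subseq_of_frequently_bounded Metric.isBounded_closedBall hbounded.frequently
  have hvr (r) : Tendsto (fun n => u (φ n) r) atTop (𝓝 (v r)) := (tendsto_pi_nhds.1 hv) r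
  refine ⟨v, W.closed_of_finiteDimensional.mem_of_tendsto hv (.of_forall fun n => huW _),
    fun r => ?_, fun r s hrs => ⟨?_, ?_⟩⟩
  · exact isClosed_setOf_mem_frontier_convexBody.mem_of_tendsto
      ((hKL.comp hφ.tendsto_atTop).prodMk_nhds (hvr r)) (.of_forall fun n => hu (φ n) r)
  · exact ge_of_tendsto ((hvr r).sub (hvr s)).norm (.of_forall fun n => (hsep (φ n) hrs).1)
  · exact ge_of_tendsto ((hvr r).add (hvr s)).norm (.of_forall fun n => (hsep (φ n) hrs).2)

end NormedSpace

variable [NormedAddCommGroup E] [InnerProductSpace ℝ E] [FiniteDimensional ℝ E] [Fintype κ]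
  {W : Submodule ℝ (κ → E)}

theorem exists_convex_not_hasSeparatedBoundaryTuple
    (hW : Module.finrank ℝ W < Fintype.card κ) {N : Seminorm ℝ E} (hN : Continuous N) {s : ℝ}
    (hs : s ≠ 0) {c : ℝ} (hc : 1 < c) {η : ℝ} (hη : 0 ≤ η)
    (hcη : 4 * ((c ^ 2) ^ 2 - 1) < (s * η) ^ 2) :
    ∃ C : Set E, Convex ℝ C ∧ IsClosed C ∧ (∀ x ∈ C, -x ∈ C) ∧
      (∀ x, roundedSeminorm N s x ≤ 1 → x ∈ C) ∧ (∀ x ∈ C, roundedSeminorm N s x ≤ c ^ 2) ∧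
      ¬HasSeparatedBoundaryTuple W η C := by
  obtain ⟨t, htM, hMt⟩ := exists_finset_dual_abs_le_seminorm_lt_mul
    (continuous_roundedSeminorm hN s) (fun x hx => roundedSeminorm_pos N hs hx) hc
  obtain ⟨β, hβ, hgeneric⟩ := exists_Ioo_forall_exists_abs_apply_ne hW (fun f : t => f.1) hc
  have hle (x) (hx : x ∈ symmetricPolytope (fun f : t => f.1) β) :
      roundedSeminorm N s x ≤ c ^ 2 := by
    rcases eq_or_ne x 0 with rfl | hx0
    · rw [map_zero]
      positivity
    obtain ⟨f, hf, hxf⟩ := hMt x hx0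
    have hfx : f x ≤ c := ((le_abs_self _).trans (hx ⟨f, hf⟩)).trans (hβ ⟨f, hf⟩).2.le
    exact hxf.le.trans (by rw [sq]; gcongr)
  refine ⟨symmetricPolytope (fun f : t => f.1) β, convex_symmetricPolytope,
    isClosed_symmetricPolytope, fun x hx f => by simpa using hx f,
    fun x hx f => (htM f f.2 x).trans (hx.trans (hβ f).1.le), hle, ?_⟩
  rintro ⟨u, huW, hu, hsep⟩
  choose i hi using fun r => exists_abs_apply_eq_of_mem_frontier_symmetricPolytope (hu r)
  have hle_u (r) := hle _ (isClosed_symmetricPolytope.frontier_subset (hu r))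
  refine (hgeneric i (fun r r' hrr' => ?_) u huW).elim fun r hr => hr (hi r)
  -- Two points of the same facet, up to sign, are close by uniform convexity.
  by_contra hne
  have hη_sq {a : ℝ} (ha : η ≤ a) : (s * η) ^ 2 ≤ (s * a) ^ 2 := by
    rw [mul_pow, mul_pow]
    gcongr
  obtain ⟨hsub, hadd⟩ := hsep hne
  rcases sq_mul_norm_sub_le_or_sq_mul_norm_add_le N s (htM (i r) (i r).2)
    ((hi r).trans (by rw [hrr', hi r'])) (by rw [hi r]; exact (hβ _).1.le) (hle_u r) (hle_u r')
    with h | h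
  · linarith [hη_sq hsub]
  · linarith [hη_sq hadd]

theorem exists_dist_lt_not_hasSeparatedBoundaryTuple
    (hW : Module.finrank ℝ W < Fintype.card κ) {η : ℝ} (hη : 0 < η) {K : ConvexBody E}
    (hneg : ∀ x ∈ K, -x ∈ K) (h0 : 0 ∈ interior (K : Set E)) {ε : ℝ} (hε : 0 < ε) :
    ∃ L : ConvexBody E, (∀ x ∈ L, -x ∈ L) ∧ 0 ∈ interior (L : Set E) ∧ dist K L < ε ∧
      ¬HasSeparatedBoundaryTuple W η (L : Set E) := by
  obtain ⟨N, hN, hNK⟩ := exists_continuous_seminorm_le_one_iff_mem K.convex K.isClosed hneg h0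
  obtain ⟨R, hR, hKR⟩ := K.isBounded.exists_pos_norm_le
  obtain ⟨τ, hτ, hτε⟩ : ∃ τ, 0 < τ ∧ τ * R < ε :=
    ⟨ε / 2 / R, by positivity, by rw [div_mul_cancel₀ _ hR.ne']; exact half_lt_self hε⟩
  obtain ⟨s, hs, hsR⟩ : ∃ s, 0 < s ∧ s * R = τ := ⟨τ / R, by positivity, div_mul_cancel₀ _ hR.ne'⟩
  obtain ⟨c, hcη, hcτ, hc⟩ :
      ∃ c : ℝ, 4 * ((c ^ 2) ^ 2 - 1) < (s * η) ^ 2 ∧ c ^ 2 < 1 + τ ∧ 1 < c := by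
    have h1 : ∀ᶠ c : ℝ in 𝓝 1, 4 * ((c ^ 2) ^ 2 - 1) < (s * η) ^ 2 :=
      ContinuousAt.eventually_lt (by fun_prop) continuousAt_const
        (by simp only [one_pow, sub_self, mul_zero]; positivity)
    have h2 : ∀ᶠ c : ℝ in 𝓝 1, c ^ 2 < 1 + τ :=
      ContinuousAt.eventually_lt (by fun_prop) continuousAt_const (by simpa)
    exact ((h1.filter_mono nhdsWithin_le_nhds).and ((h2.filter_mono nhdsWithin_le_nhds).and
      (self_mem_nhdsWithin (s := Set.Ioi 1)))).exists
  obtain ⟨C, hconv, hclosed, hCneg, hMC, hCM, hC⟩ :=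
    exists_convex_not_hasSeparatedBoundaryTuple hW hN hs.ne' hc hη.le hcη
  have hτ1 : 0 < 1 + τ := by positivity
  have hscale (p : Seminorm ℝ E) (x) : p ((1 + τ)⁻¹ • x) ≤ 1 ↔ p x ≤ 1 + τ := by
    rw [map_smul_eq_mul, Real.norm_of_nonneg (inv_nonneg.2 hτ1.le), inv_mul_le_one₀ hτ1]
  have hKC (x) (hx : x ∈ K) : (1 + τ)⁻¹ • x ∈ C := by
    refine hMC _ ((hscale _ x).2 (roundedSeminorm_le_of_le_one N s ((hNK x).2 hx) hτ.le ?_))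
    rw [abs_of_nonneg (by positivity), ← hsR]
    exact mul_le_mul_of_nonneg_left (hKR x hx) hs.le
  have hCK (x) (hx : x ∈ C) : (1 + τ)⁻¹ • x ∈ K :=
    (hNK _).1 ((hscale N x).2 ((le_roundedSeminorm N s x).trans ((hCM x hx).trans hcτ.le)))
  obtain ⟨L, rfl, hKL⟩ := exists_convexBody_coe_eq_dist_le hconv hclosed hτ.le hKR hKC hCK
  exact ⟨L, hCneg, zero_mem_interior_of_smul_mem (inv_ne_zero hτ1.ne') h0 hKC, hKL.trans_lt hτε, hC⟩

end BoundaryTuples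

section RationalDependence

theorem exists_pairwise_one_div_le_norm {E : Type*} [NormedAddCommGroup E] {k : ℕ}
    {u : Fin k → E} (hu : Pairwise fun r s => u r ≠ u s ∧ u r ≠ -u s) :
    ∃ m : ℕ, Pairwise fun r s =>
      1 / ((m : ℝ) + 1) ≤ ‖u r - u s‖ ∧ 1 / ((m : ℝ) + 1) ≤ ‖u r + u s‖ := by
  refine Filter.Eventually.exists (f := Filter.atTop) ?_
  simp only [Pairwise, Filter.eventually_all]
  intro r s hrs
  have hev {x : E} (hx : x ≠ 0) : ∀ᶠ m : ℕ in Filter.atTop, 1 / ((m : ℝ) + 1) ≤ ‖x‖ :=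
    tendsto_one_div_add_atTop_nhds_zero_nat.eventually_le_const (norm_pos_iff.2 hx)
  exact (hev (sub_ne_zero.2 (hu hrs).1)).and
    (hev fun h => (hu hrs).2 (eq_neg_of_add_eq_zero_left h))

variable {E : Type*} [NormedAddCommGroup E] [NormedSpace ℝ E]

/-- The tuples `(∑ j, A r j • v j)_r`, where the coefficients `A` are fixed and the vectors `v j`
vary. -/
def rationalTuples (E : Type*) [AddCommGroup E] [Module ℝ E] {k l : ℕ}
    (A : Matrix (Fin k) (Fin l) ℚ) : Submodule ℝ (Fin k → E) :=
  LinearMap.range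
    (LinearMap.pi fun r => ∑ j, (A r j : ℝ) • LinearMap.proj j : (Fin l → E) →ₗ[ℝ] Fin k → E)

theorem finrank_rationalTuples_le (E : Type*) [AddCommGroup E] [Module ℝ E] [Module.Finite ℝ E]
    {k l : ℕ} (A : Matrix (Fin k) (Fin l) ℚ) :
    Module.finrank ℝ (rationalTuples E A) ≤ Module.finrank ℝ E * l :=
  (LinearMap.finrank_range_le _).trans_eq (by simp [Module.finrank_pi_fintype, mul_comm])

variable [Module ℚ E]

/-- The boundary of `C` has a finite set of points, no two of them opposite, whose rational rank is
less than the `1/d`-th part of its size, where `d` is the real dimension of the space. -/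
def HasRationallyDependentBoundary (C : Set E) : Prop :=
  ∃ T : Finset E, (T : Set E) ⊆ frontier C ∧ (∀ u ∈ T, -u ∉ T) ∧
    Module.finrank ℝ E * Module.finrank ℚ (Submodule.span ℚ (T : Set E)) < T.card

theorem exists_matrix_mem_rationalTuples {k : ℕ} (u : Fin k → E) :
    ∃ A : Matrix (Fin k) (Fin (Module.finrank ℚ (Submodule.span ℚ (Set.range u)))) ℚ,
      u ∈ rationalTuples E A := by
  have : Module.Finite ℚ (Submodule.span ℚ (Set.range u)) := .span_of_finite ℚ (Set.finite_range u)
  let b := Module.finBasis ℚ (Submodule.span ℚ (Set.range u))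
  let w (r) : Submodule.span ℚ (Set.range u) := ⟨u r, Submodule.subset_span ⟨r, rfl⟩⟩
  refine ⟨fun r j => b.repr (w r) j, fun j => b j, funext fun r => ?_⟩
  have hsum : ∑ j, b.repr (w r) j • (b j : E) = u r := by
    simpa only [AddSubmonoidClass.coe_finsetSum, SetLike.val_smul]
      using congrArg Subtype.val (b.sum_repr (w r))
  simpa [Rat.cast_smul_eq_qsmul] using hsum

theorem HasRationallyDependentBoundary.exists_hasSeparatedBoundaryTuple {C : Set E}
    (hC : HasRationallyDependentBoundary C) :
    ∃ (k l : ℕ) (A : Matrix (Fin k) (Fin l) ℚ) (m : ℕ), Module.finrank ℝ E * l < k ∧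
      HasSeparatedBoundaryTuple (rationalTuples E A) (1 / ((m : ℝ) + 1)) C := by
  obtain ⟨T, hTC, hneg, hcard⟩ := hC
  let u (r : Fin T.card) : E := T.equivFin.symm r
  have huT (r) : u r ∈ T := (T.equivFin.symm r).2
  have hrange : Set.range u = T := by
    ext x
    exact ⟨fun ⟨r, hr⟩ => hr ▸ huT r, fun hx => ⟨T.equivFin ⟨x, hx⟩, by simp [u]⟩⟩
  obtain ⟨A, hA⟩ := exists_matrix_mem_rationalTuples u
  obtain ⟨m, hm⟩ := exists_pairwise_one_div_le_norm (u := u) fun r s hrs =>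
    ⟨fun h => hrs (T.equivFin.symm.injective (Subtype.ext h)),
      fun h => hneg _ (huT s) (h ▸ huT r)⟩
  exact ⟨_, _, A, m, by rwa [hrange], u, hA, fun r => hTC (huT r), hm⟩

end RationalDependence

section SymmetricBodies

variable {d : ℕ}

theorem isNowhereDense_setOf_hasSeparatedBoundaryTuple {κ : Type*} [Fintype κ]
    {W : Submodule ℝ (κ → EuclideanSpace ℝ (Fin d))} (hW : Module.finrank ℝ W < Fintype.card κ)
    {η : ℝ} (hη : 0 < η) :
    IsNowhereDense {K : SymmetricBody d |
      HasSeparatedBoundaryTuple W η (K.1 : Set (EuclideanSpace ℝ (Fin d)))} := by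
  have hclosed := (isClosed_setOf_hasSeparatedBoundaryTuple W η).preimage
    (continuous_subtype_val (p := fun K : ConvexBody (EuclideanSpace ℝ (Fin d)) =>
      (∀ x ∈ K, -x ∈ K) ∧ 0 ∈ interior (K : Set (EuclideanSpace ℝ (Fin d)))))
  refine hclosed.isNowhereDense_iff.2 (interior_eq_empty_iff_dense_compl.2 ?_)
  refine Metric.dense_iff.2 fun K ε hε => ?_
  obtain ⟨L, hneg, h0, hKL, hL⟩ :=
    exists_dist_lt_not_hasSeparatedBoundaryTuple hW hη K.2.1 K.2.2 hε
  exact ⟨⟨L, hneg, h0⟩, Metric.mem_ball'.2 hKL, hL⟩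

theorem isMeagre_setOf_hasRationallyDependentBoundary (d : ℕ) :
    IsMeagre {K : SymmetricBody d |
      HasRationallyDependentBoundary (K.1 : Set (EuclideanSpace ℝ (Fin d)))} := by
  have hmatrix (k l : ℕ) : Countable (Matrix (Fin k) (Fin l) ℚ) :=
    inferInstanceAs (Countable (Fin k → Fin l → ℚ))
  refine (isMeagre_iUnion fun p : {p : (Σ k l : ℕ, Matrix (Fin k) (Fin l) ℚ) × ℕ //
      Module.finrank ℝ (EuclideanSpace ℝ (Fin d)) * p.1.2.1 < p.1.1} =>
    (isNowhereDense_setOf_hasSeparatedBoundaryTuple (W := rationalTuples _ p.1.1.2.2)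
      (((finrank_rationalTuples_le _ _).trans_lt p.2).trans_eq (Fintype.card_fin _).symm)
      (Nat.one_div_pos_of_nat (n := p.1.2))).isMeagre).mono fun K hK => ?_
  obtain ⟨k, l, A, m, hkl, h⟩ := HasRationallyDependentBoundary.exists_hasSeparatedBoundaryTuple hK
  exact Set.mem_iUnion.2 ⟨⟨⟨⟨k, l, A⟩, m⟩, hkl⟩, h⟩

end SymmetricBodies

theorem theorem1p1 (d : ℕ) (hd : 2 ≤ d) :
    ∃ M : Set (SymmetricBody d), IsMeagre M ∧
      ∀ N : DNorm d, N.unitBall ∉ M →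
        ∀ n : ℕ, 1 ≤ n → ∀ P : Finset (EuclideanSpace ℝ (Fin d)), P.card = n →
          (N.numUnitDistances P : ℝ) ≤ (d : ℝ) / 2 * n * Real.logb 2 n := by
  classical
  refine ⟨_, isMeagre_setOf_hasRationallyDependentBoundary d, fun N hN n _ P hP => ?_⟩
  have : IsAddTorsionFree (EuclideanSpace ℝ (Fin d)) := .of_module_rat _
  let D := {u ∈ (P ×ˢ P).image fun p => p.1 - p.2 | N.toSeminorm u = 1}
  have hD (u) (hu : u ∈ D) : N.toSeminorm u = 1 := (Finset.mem_filter.1 hu).2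
  obtain ⟨S, hSD, hneg, hcover⟩ := exists_subset_neg_notMem_forall_mem_or_neg_mem (D := D)
    fun u hu h => by simpa [self_eq_neg.1 h.symm] using hD u hu
  have hedges : N.numUnitDistances P ≤ ∑ u ∈ S, translateCount P u :=
    ncard_edgeSet_induce_le_sum_translateCount N.unitDistanceGraph fun x hx y hy hxy => by
      simpa using hcover (x - y) (Finset.mem_filter.2
        ⟨Finset.mem_image.2 ⟨(x, y), Finset.mk_mem_product hx hy, rfl⟩, hxy⟩)
  have hrank (T) (hT : T ⊆ S) :
      T.card ≤ d * Module.finrank ℚ (Submodule.span ℚ (T : Set (EuclideanSpace ℝ (Fin d)))) := by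
    by_contra! hlt
    exact hN ⟨T, fun u hu => mem_frontier_setOf_le_one (hD u (hSD (hT hu))),
      fun u hu hu' => hneg u (hT hu) (hT hu'), by rwa [finrank_euclideanSpace_fin]⟩
  have hsum := two_mul_sum_translateCount_le_mul_card hrank P
  rw [← Nat.cast_sum, hP] at hsum
  have hedges' : (N.numUnitDistances P : ℝ) ≤ (∑ u ∈ S, translateCount P u : ℕ) := mod_cast hedges
  linarith
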